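/- Let $N\in\mathbb N$ and let $M_N(\mathbb C)$ carry the Hilbert–Schmidt inner product $\langle A,B\rangle=\operatorname{Tr}(A^*B)$. A quantum dynamical semigroup (QDS) on $M_N(\mathbb C)$ is a family $(T_t)_{t\ge 0}$ of linear maps of $M_N(\mathbb C)$ such that $T_0=\mathrm{id}$, $T_{t+s}=T_tT_s$, $t\mapsto T_t(A)$ is continuous for every $A$, $\operatorname{Tr}(T_t(A))=\operatorname{Tr}(A)$ for all $A$ and $t$, and every $T_t$ is completely positive; its generator is $\mathcal L(x)=\lim_{t\downarrow 0}\frac1t(T_t(x)-x)$. Let $F_1,\dots,F_{N^2}\in M_N(\mathbb C)$ be orthonormal. A linear operator $\mathcal L:M_N(\mathbb C)\to M_N(\mathbb C)$ is the generator of a QDS on $M_N(\mathbb C)$ if and only if it can be expressed in the form $$\mathcal L(\rho)=-i[H,\rho]+\frac12\sum_{i,j=1}^{N^2}\gamma_{ij}\bigl([F_i,\rho F_j^*]+[F_i\rho,F_j^*]\bigr)\qquad(\rho\in M_N(\mathbb C))\tag{1}$$ with $H\in M_N(\mathbb C)$ traceless and Hermitian and $\Gamma=(\gamma_{ij})$ an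 $N^2\times N^2$ complex matrix which, regarded as the operator on $M_N(\mathbb C)$ given by $\Gamma(F_j)=\sum_i\gamma_{ij}F_i$, satisfies - $\Gamma\ge 0$ (positive semidefinite), - $\Gamma(I_N)=0$, and - $\operatorname{Tr}(\Gamma(A))=0$ for all $A\in M_N(\mathbb C)$. Moreover, in every such representation of a given $\mathcal L$, the matrix $\Gamma$ is uniquely determined by $\mathcal L$ and the choice of the $F_i$, and $H$ is uniquely determined by $\mathcal L$ alone (it is the same for all orthonormal bases). This $H$ is also the traceless Hamiltonian of the classical GKSL form: for all traceless orthonormal $E_1,\dots,E_{N^2-1}\in M_N(\mathbb C)$, $H$ is the one and only traceless Hermitian matrix $H'$ for which there is a positive semidefinite $(N^2-1)\times(N^2-1)$ matrix $C=(c_{ij})$ with $$\mathcal L(\rho)=-i[H',\rho]+\frac12\sum_{i,j=1}^{N^2-1}c_{ij}\bigl([E_i,\rho E_j^*]+[E_i\rho,E_j^*]\bigr)\qquad(\rho\in M_N(\mathbb C)).$$ -/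

import Mathlib

open Filter Topology
open scoped NNReal Matrix ComplexOrder

/-- `M N` is the space `M_N(ℂ)` of complex `N × N` matrices. -/
abbrev M (N : ℕ) : Type := Matrix (Fin N) (Fin N) ℂ

/-- The block map `id_k ⊗ T` on `M_k(M_N(ℂ))`, applying `T` to each of the `k × k` blocks. -/
def ampliation {N : ℕ} (T : M N →ₗ[ℂ] M N) (k : ℕ)
    (X : Matrix (Fin k × Fin N) (Fin k × Fin N) ℂ) :
    Matrix (Fin k × Fin N) (Fin k × Fin N) ℂ :=
  Matrix.of fun p q => T (Matrix.of fun a b => X (p.1, a) (q.1, b)) p.2 q.2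

/-- Complete positivity: `id_k ⊗ T` preserves positive semidefiniteness for every `k`. -/
def IsCompletelyPositive {N : ℕ} (T : M N →ₗ[ℂ] M N) : Prop :=
  ∀ (k : ℕ) (X : Matrix (Fin k × Fin N) (Fin k × Fin N) ℂ),
    X.PosSemidef → (ampliation T k X).PosSemidef

/-- Quantum dynamical semigroups (Schrödinger picture) on `M_N(ℂ)`. -/
structure IsQDS {N : ℕ} (T : ℝ≥0 → (M N →ₗ[ℂ] M N)) : Prop where
  zero : T 0 = LinearMap.id
  add : ∀ t s : ℝ≥0, T (t + s) = T t ∘ₗ T s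
  cont : ∀ A : M N, Continuous fun t : ℝ≥0 => T t A
  trace : ∀ (t : ℝ≥0) (A : M N), (T t A).trace = A.trace
  completelyPositive : ∀ t : ℝ≥0, IsCompletelyPositive (T t)

/-- `L` is the generator of a QDS `(T_t)`: `L x = lim_{t ↓ 0} (T_t x - x) / t` for all `x`. -/
def IsQDSGenerator {N : ℕ} (L : M N →ₗ[ℂ] M N) : Prop :=
  ∃ T : ℝ≥0 → (M N →ₗ[ℂ] M N), IsQDS T ∧
    ∀ x : M N, Tendsto (fun t : ℝ≥0 => (t : ℝ)⁻¹ • (T t x - x)) (𝓝[>] 0) (𝓝 (L x))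

/-- Orthonormality for the Hilbert–Schmidt inner product `⟨A, B⟩ = Tr(A* B)`. -/
def IsHSOrthonormal {N m : ℕ} (F : Fin m → M N) : Prop :=
  ∀ i j, ((F i)ᴴ * F j).trace = if i = j then 1 else 0

/-- The value at `ρ` of the GKSL expression with Hamiltonian `H` and coefficient matrix `Γ`. -/
noncomputable def gkslForm {N m : ℕ} (F : Fin m → M N) (H : M N)
    (Γ : Matrix (Fin m) (Fin m) ℂ) (ρ : M N) : M N :=
  -(Complex.I • ⁅H, ρ⁆) +
    (1 / 2 : ℂ) • ∑ i, ∑ j, Γ i j • (⁅F i, ρ * (F j)ᴴ⁆ + ⁅F i * ρ, (F j)ᴴ⁆)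

/-- The operator on `M_N(ℂ)` whose matrix in the orthonormal basis `F` is `Γ`, that is,
`Γ(F_j) = ∑ i, γ_ij F_i`; the coordinates of `A` are `⟨F_j, A⟩ = Tr(F_j* A)`. -/
noncomputable def coeffOperator {N m : ℕ} (F : Fin m → M N)
    (Γ : Matrix (Fin m) (Fin m) ℂ) (A : M N) : M N :=
  ∑ i, ∑ j, (Γ i j * ((F j)ᴴ * A).trace) • F i

/-- `L` is written over the orthonormal basis `F` with traceless Hermitian `H` and a matrix
`Γ ≥ 0` whose operator annihilates the identity and has traceless range. -/
structure IsDilatedGKSLRep {N : ℕ} (F : Fin (N ^ 2) → M N) (L : M N →ₗ[ℂ] M N)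
    (H : M N) (Γ : Matrix (Fin (N ^ 2)) (Fin (N ^ 2)) ℂ) : Prop where
  hermitian : H.IsHermitian
  traceless : H.trace = 0
  posSemidef : Γ.PosSemidef
  map_one : coeffOperator F Γ 1 = 0
  trace_map : ∀ A : M N, (coeffOperator F Γ A).trace = 0
  eq_form : ∀ ρ : M N, L ρ = gkslForm F H Γ ρ

/-- The classical GKSL form of `L`, over `N² - 1` traceless orthonormal matrices `E`, with
traceless Hamiltonian `H` and positive semidefinite coefficient matrix `C`. -/
structure IsClassicalGKSLRep {N : ℕ} (E : Fin (N ^ 2 - 1) → M N) (L : M N →ₗ[ℂ] M N)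
    (H : M N) (C : Matrix (Fin (N ^ 2 - 1)) (Fin (N ^ 2 - 1)) ℂ) : Prop where
  hermitian : H.IsHermitian
  traceless : H.trace = 0
  posSemidef : C.PosSemidef
  eq_form : ∀ ρ : M N, L ρ = gkslForm E H C ρ

/-! Encode maps by Choi matrices: `ρ ↦ A ρ Bᴴ` has Choi matrix `vec A (vec B)ᴴ`. If `V` has columns
`vec (F i)`, the GKSL expression depends on `F` and `Γ` only through `G = V Γ Vᴴ`, and it equals
`choiMap G ρ + K ρ + ρ Kᴴ` with `K = -i H - choiDual G / 2`. The two `K` terms contribute the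
rank-one matrices `vec K (vec 1)ᴴ` and `vec 1 (vec K)ᴴ`, which the projection `P` off `vec 1` kills
on one side each. The conditions on `Γ` say that `G` is positive semidefinite and supported on the
range of `P`, so `G = P (choi L) P` (`choi_eq`). This determines `G`, and then `H` up to a scalar,
which tracelessness removes.

For a generator, `P (choi L) P` is a limit of the positive semidefinite matrices `P (choi (T t)) P /
t`, since `P` kills the Choi matrix of the identity; the rest of `choi L` has the two-term form
above, and trace preservation fixes the Hermitian part of `K`. Conversely, `exp (t L)` is completely
positive because `1 + ε L` is so up to order `ε²` (`exp_smul_mem_of_quadratic_mem`). -/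

open Matrix

variable {N : ℕ}

/-! ### Choi matrices and the GKSL expression -/

/-- The linear map on `M_N(ℂ)` with Choi matrix `G`. -/
def choiMap (G : Matrix (Fin N × Fin N) (Fin N × Fin N) ℂ) : M N →ₗ[ℂ] M N where
  toFun ρ := Matrix.of fun a b => ∑ i, ∑ j, G (i, a) (j, b) * ρ i j
  map_add' ρ σ := by
    ext a b
    simp [mul_add, Finset.sum_add_distrib]
  map_smul' c ρ := by
    ext a b
    simp [Finset.mul_sum, mul_left_comm]

/-- The Choi matrix of a linear map on `M_N(ℂ)`. -/
def choi : (M N →ₗ[ℂ] M N) →ₗ[ℂ] Matrix (Fin N × Fin N) (Fin N × Fin N) ℂ where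
  toFun T := Matrix.of fun p q => T (Matrix.single p.1 q.1 1) p.2 q.2
  map_add' T S := by ext; simp
  map_smul' c T := by ext; simp

/-- The image of the identity under the adjoint of `choiMap G`. -/
def choiDual (G : Matrix (Fin N × Fin N) (Fin N × Fin N) ℂ) : M N :=
  Matrix.of fun i j => ∑ a, G (j, a) (i, a)

theorem choiMap_apply (G : Matrix (Fin N × Fin N) (Fin N × Fin N) ℂ) (ρ : M N) (a b : Fin N) :
    choiMap G ρ a b = ∑ i, ∑ j, G (i, a) (j, b) * ρ i j := rfl

theorem choi_apply (T : M N →ₗ[ℂ] M N) (p q : Fin N × Fin N) :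
    choi T p q = T (Matrix.single p.1 q.1 1) p.2 q.2 := rfl

theorem choiMap_add (G G' : Matrix (Fin N × Fin N) (Fin N × Fin N) ℂ) :
    choiMap (G + G') = choiMap G + choiMap G' := by
  ext ρ a b
  simp [choiMap_apply, add_mul, Finset.sum_add_distrib]

theorem choiMap_smul (c : ℂ) (G : Matrix (Fin N × Fin N) (Fin N × Fin N) ℂ) :
    choiMap (c • G) = c • choiMap G := by
  ext ρ a b
  simp [choiMap_apply, Finset.mul_sum, mul_assoc]

theorem choiMap_sum {ι : Type*} (s : Finset ι)
    (G : ι → Matrix (Fin N × Fin N) (Fin N × Fin N) ℂ) :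
    choiMap (∑ k ∈ s, G k) = ∑ k ∈ s, choiMap (G k) :=
  map_sum (AddMonoidHom.mk' choiMap choiMap_add) G s

theorem choiMap_choi (T : M N →ₗ[ℂ] M N) : choiMap (choi T) = T := by
  ext ρ a b
  conv_rhs => rw [Matrix.matrix_eq_sum_single ρ]
  simp only [map_sum, Matrix.sum_apply, choiMap_apply, choi_apply]
  refine Finset.sum_congr rfl fun i _ => Finset.sum_congr rfl fun j _ => ?_
  have : Matrix.single i j (ρ i j) = ρ i j • Matrix.single i j (1 : ℂ) := by simp
  rw [this, map_smul, Matrix.smul_apply, smul_eq_mul, mul_comm]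

theorem choi_choiMap (G : Matrix (Fin N × Fin N) (Fin N × Fin N) ℂ) : choi (choiMap G) = G := by
  ext ⟨i, a⟩ ⟨j, b⟩
  simp [choi_apply, choiMap_apply, Matrix.single_apply, ite_and]

theorem choiMap_vecMulVec (A B ρ : M N) :
    choiMap (vecMulVec (vec A) (star (vec B))) ρ = A * ρ * Bᴴ := by
  ext a b
  simp only [choiMap_apply, vecMulVec_apply, Matrix.mul_apply, Finset.sum_mul, vec, Pi.star_apply,
    conjTranspose_apply]
  rw [Finset.sum_comm]
  refine Finset.sum_congr rfl fun i _ => Finset.sum_congr rfl fun j _ => ?_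
  ring

theorem choiDual_add (G G' : Matrix (Fin N × Fin N) (Fin N × Fin N) ℂ) :
    choiDual (G + G') = choiDual G + choiDual G' := by
  ext i j
  simp [choiDual, Finset.sum_add_distrib]

theorem choiDual_smul (c : ℂ) (G : Matrix (Fin N × Fin N) (Fin N × Fin N) ℂ) :
    choiDual (c • G) = c • choiDual G := by
  ext i j
  simp [choiDual, Finset.mul_sum]

theorem choiDual_sum {ι : Type*} (s : Finset ι)
    (G : ι → Matrix (Fin N × Fin N) (Fin N × Fin N) ℂ) :
    choiDual (∑ k ∈ s, G k) = ∑ k ∈ s, choiDual (G k) :=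
  map_sum (AddMonoidHom.mk' choiDual choiDual_add) G s

theorem choiDual_vecMulVec (A B : M N) :
    choiDual (vecMulVec (vec A) (star (vec B))) = Bᴴ * A := by
  ext i j
  simp [choiDual, vecMulVec_apply, Matrix.mul_apply, vec, mul_comm]

theorem isHermitian_choiDual {G : Matrix (Fin N × Fin N) (Fin N × Fin N) ℂ}
    (hG : G.IsHermitian) : (choiDual G).IsHermitian := by
  ext i j
  simp [choiDual, fun a => hG.apply (j, a) (i, a)]

theorem trace_choiMap (G : Matrix (Fin N × Fin N) (Fin N × Fin N) ℂ) (ρ : M N) :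
    (choiMap G ρ).trace = (choiDual G * ρ).trace := by
  simp only [Matrix.trace, Matrix.diag_apply, choiMap_apply, Matrix.mul_apply, choiDual,
    Matrix.of_apply, Finset.sum_mul]
  conv_rhs => rw [Finset.sum_comm]
  rw [Finset.sum_comm]
  exact Finset.sum_congr rfl fun i _ => Finset.sum_comm

/-- The matrix whose columns are the vectorizations of the matrices `F k`. -/
def vecColumns {m : ℕ} (F : Fin m → M N) : Matrix (Fin N × Fin N) (Fin m) ℂ :=
  Matrix.of fun p k => vec (F k) p

theorem vecColumns_mul_mul {m : ℕ} (F : Fin m → M N) (Γ : Matrix (Fin m) (Fin m) ℂ) :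
    vecColumns F * Γ * (vecColumns F)ᴴ =
      ∑ i, ∑ j, Γ i j • vecMulVec (vec (F i)) (star (vec (F j))) := by
  ext p q
  simp only [Matrix.mul_apply, vecColumns, Matrix.of_apply, conjTranspose_apply, Finset.sum_mul,
    Matrix.sum_apply, Matrix.smul_apply, vecMulVec_apply, Pi.star_apply, smul_eq_mul]
  rw [Finset.sum_comm]
  refine Finset.sum_congr rfl fun i _ => Finset.sum_congr rfl fun j _ => ?_
  ring

/-- The basis disappears here: dilated and classical forms become instances of a single expression
in `G`. -/
theorem gkslForm_eq {m : ℕ} (F : Fin m → M N) (H : M N) (Γ : Matrix (Fin m) (Fin m) ℂ)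
    (G : Matrix (Fin N × Fin N) (Fin N × Fin N) ℂ)
    (hG : vecColumns F * Γ * (vecColumns F)ᴴ = G) (ρ : M N) :
    gkslForm F H Γ ρ = -(Complex.I • ⁅H, ρ⁆) + choiMap G ρ
      - (1 / 2 : ℂ) • (choiDual G * ρ + ρ * choiDual G) := by
  rw [← hG, vecColumns_mul_mul, choiMap_sum, choiDual_sum, gkslForm, add_sub_assoc]
  congr 1
  simp only [choiMap_sum, choiDual_sum, choiMap_smul, choiDual_smul, LinearMap.sum_apply,
    LinearMap.smul_apply, choiMap_vecMulVec, choiDual_vecMulVec, Finset.sum_mul, Finset.mul_sum,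
    ← Finset.sum_add_distrib, Finset.smul_sum, ← Finset.sum_sub_distrib]
  refine Finset.sum_congr rfl fun i _ => Finset.sum_congr rfl fun j _ => ?_
  simp only [Ring.lie_def, smul_mul_assoc, mul_smul_comm, mul_assoc]
  module

/-! ### Basis-free representations and their uniqueness -/

/-- The basis-free form of a GKSL representation, with the coefficients gathered in the Choi
matrix `G`. -/
structure IsChoiGKSLRep (L : M N →ₗ[ℂ] M N) (H : M N)
    (G : Matrix (Fin N × Fin N) (Fin N × Fin N) ℂ) : Prop where
  hermitian : H.IsHermitian
  traceless : H.trace = 0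
  posSemidef : G.PosSemidef
  mulVec_one : G *ᵥ vec (1 : M N) = 0
  eq_form : ∀ ρ : M N, L ρ = -(Complex.I • ⁅H, ρ⁆) + choiMap G ρ
      - (1 / 2 : ℂ) • (choiDual G * ρ + ρ * choiDual G)

theorem conjTranspose_vecColumns_mulVec {m : ℕ} (F : Fin m → M N) (A : M N) (j : Fin m) :
    ((vecColumns F)ᴴ *ᵥ vec A) j = ((F j)ᴴ * A).trace := by
  rw [← star_vec_dotProduct_vec]
  rfl

theorem conjTranspose_vecColumns_mul_self {m : ℕ} {F : Fin m → M N} (hF : IsHSOrthonormal F) :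
    (vecColumns F)ᴴ * vecColumns F = 1 := by
  ext i j
  rw [Matrix.one_apply, ← hF i j, ← conjTranspose_vecColumns_mulVec]
  rfl

theorem vecColumns_mul_conjTranspose {F : Fin (N ^ 2) → M N} (hF : IsHSOrthonormal F) :
    vecColumns F * (vecColumns F)ᴴ = 1 :=
  (mul_eq_one_comm_of_card_eq _ _ _ (by simp [sq])).1 (conjTranspose_vecColumns_mul_self hF)

theorem conjTranspose_vecColumns_mul_mul {m : ℕ} {F : Fin m → M N} (hF : IsHSOrthonormal F)
    (Γ : Matrix (Fin m) (Fin m) ℂ) :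
    (vecColumns F)ᴴ * (vecColumns F * Γ * (vecColumns F)ᴴ) * vecColumns F = Γ := by
  rw [Matrix.mul_assoc (vecColumns F), ← Matrix.mul_assoc, conjTranspose_vecColumns_mul_self hF,
    Matrix.one_mul, Matrix.mul_assoc, conjTranspose_vecColumns_mul_self hF, Matrix.mul_one]

theorem vec_coeffOperator {m : ℕ} (F : Fin m → M N) (Γ : Matrix (Fin m) (Fin m) ℂ) (A : M N) :
    vec (coeffOperator F Γ A) = (vecColumns F * Γ * (vecColumns F)ᴴ) *ᵥ vec A := by
  rw [← mulVec_mulVec, ← mulVec_mulVec]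
  ext p
  simp only [coeffOperator, vec_sum, vec_smul, Finset.sum_apply, Pi.smul_apply, smul_eq_mul,
    ← conjTranspose_vecColumns_mulVec]
  generalize (vecColumns F)ᴴ *ᵥ vec A = w
  simp only [mulVec, dotProduct, vecColumns, Matrix.of_apply, Finset.mul_sum]
  refine Finset.sum_congr rfl fun i _ => Finset.sum_congr rfl fun j _ => ?_
  ring

/-- The projection of `M_N(ℂ)` onto the orthogonal complement of the identity. -/
noncomputable def projTraceless (N : ℕ) : Matrix (Fin N × Fin N) (Fin N × Fin N) ℂ :=
  1 - (N : ℂ)⁻¹ • vecMulVec (vec (1 : M N)) (star (vec (1 : M N)))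

theorem star_vec_one_dotProduct : star (vec (1 : M N)) ⬝ᵥ vec (1 : M N) = N := by
  rw [star_vec_dotProduct_vec]
  simp

theorem conjTranspose_projTraceless : (projTraceless N)ᴴ = projTraceless N := by
  simp [projTraceless, conjTranspose_vecMulVec]

theorem projTraceless_mulVec_one : projTraceless N *ᵥ vec (1 : M N) = 0 := by
  rcases eq_or_ne N 0 with rfl | hN
  · ext p
    exact p.1.elim0
  · rw [projTraceless, sub_mulVec, smul_mulVec, vecMulVec_mulVec, star_vec_one_dotProduct]
    ext p
    have : (N : ℂ) ≠ 0 := Nat.cast_ne_zero.2 hN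
    simp
    field_simp
    simp

theorem star_vec_one_vecMul_projTraceless :
    star (vec (1 : M N)) ᵥ* projTraceless N = 0 := by
  have := congrArg star (projTraceless_mulVec_one (N := N))
  rwa [star_mulVec, conjTranspose_projTraceless, star_zero] at this

theorem choi_normal (K : M N) (G : Matrix (Fin N × Fin N) (Fin N × Fin N) ℂ)
    (L : M N →ₗ[ℂ] M N) (h : ∀ ρ, L ρ = choiMap G ρ + K * ρ + ρ * Kᴴ) :
    choi L = G + vecMulVec (vec K) (star (vec (1 : M N)))
      + vecMulVec (vec (1 : M N)) (star (vec K)) := by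
  rw [← choi_choiMap (_ + _)]
  congr 1
  ext1 ρ
  rw [choiMap_add, choiMap_add, h]
  simp only [LinearMap.add_apply, choiMap_vecMulVec]
  simp

namespace IsChoiGKSLRep

variable {L : M N →ₗ[ℂ] M N} {H : M N} {G : Matrix (Fin N × Fin N) (Fin N × Fin N) ℂ}

theorem vecMul_one (h : IsChoiGKSLRep L H G) : star (vec (1 : M N)) ᵥ* G = 0 := by
  have := congrArg star h.mulVec_one
  rwa [star_mulVec, h.posSemidef.isHermitian.eq, star_zero] at this

theorem eq_form' (h : IsChoiGKSLRep L H G) (ρ : M N) :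
    L ρ = choiMap G ρ + (-(Complex.I • H) - (1 / 2 : ℂ) • choiDual G) * ρ
      + ρ * (-(Complex.I • H) - (1 / 2 : ℂ) • choiDual G)ᴴ := by
  rw [h.eq_form, conjTranspose_sub, conjTranspose_neg, conjTranspose_smul, conjTranspose_smul,
    h.hermitian.eq, (isHermitian_choiDual h.posSemidef.isHermitian).eq]
  simp only [Ring.lie_def, sub_mul, mul_sub, neg_mul, mul_neg, smul_mul_assoc, mul_smul_comm,
    Complex.star_def, Complex.conj_I, map_div₀, map_one, map_ofNat]
  module

theorem projTraceless_mul_mul (h : IsChoiGKSLRep L H G) :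
    projTraceless N * G * projTraceless N = G := by
  have h1 : projTraceless N * G = G := by
    rw [projTraceless, sub_mul, smul_mul_assoc, vecMulVec_mul, h.vecMul_one]
    simp
  rw [h1, projTraceless, mul_sub, mul_smul_comm, mul_vecMulVec, h.mulVec_one]
  simp

/-- The terms carrying `H` have a factor `vec 1` on one side, so compression by the projection
leaves only `G`. -/
theorem choi_eq (h : IsChoiGKSLRep L H G) :
    projTraceless N * choi L * projTraceless N = G := by
  rw [choi_normal _ _ _ h.eq_form', mul_add, mul_add, add_mul, add_mul, h.projTraceless_mul_mul,
    mul_vecMulVec, mul_vecMulVec, vecMulVec_mul, vecMulVec_mul, projTraceless_mulVec_one,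
    star_vec_one_vecMul_projTraceless]
  simp

theorem choi_unique {H' : M N} {G' : Matrix (Fin N × Fin N) (Fin N × Fin N) ℂ}
    (h : IsChoiGKSLRep L H G) (h' : IsChoiGKSLRep L H' G') : G' = G :=
  h'.choi_eq.symm.trans h.choi_eq

theorem hamiltonian_unique {H' : M N} {G' : Matrix (Fin N × Fin N) (Fin N × Fin N) ℂ}
    (h : IsChoiGKSLRep L H G) (h' : IsChoiGKSLRep L H' G') : H' = H := by
  obtain rfl := h.choi_unique h'
  have hc : ∀ ρ, Commute ρ (H' - H) := fun ρ => by
    have := (h.eq_form ρ).symm.trans (h'.eq_form ρ)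
    simp only [sub_left_inj, add_left_inj, neg_inj] at this
    have := smul_right_injective _ Complex.I_ne_zero this
    simp only [Ring.lie_def] at this
    have h0 : H * ρ - ρ * H = H' * ρ - ρ * H' := this
    rw [Commute, SemiconjBy, sub_mul, mul_sub, ← sub_eq_zero]
    rw [← sub_eq_zero] at h0
    rw [← h0]
    abel
  -- With equal `G`, the difference of the Hamiltonians is central, hence a scalar, and its trace `N
  -- c` vanishes.
  obtain ⟨c, hc⟩ := mem_range_scalar_iff_commute_single'.2 fun i j => hc (single i j 1)
  rcases eq_or_ne N 0 with rfl | hN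
  · exact Subsingleton.elim _ _
  · have ht := congrArg Matrix.trace hc
    rw [trace_sub, h.traceless, h'.traceless] at ht
    have : c = 0 := by simpa [hN] using ht
    rw [this, map_zero] at hc
    exact sub_eq_zero.1 hc.symm

end IsChoiGKSLRep

/-! ### Dilated and classical representations -/

/-- `V` is unitary, so positivity passes both ways. Traceless range is the adjoint of the condition
at the identity, and follows from it as `G` is Hermitian. -/
theorem isDilatedGKSLRep_iff {F : Fin (N ^ 2) → M N} (hF : IsHSOrthonormal F)
    {L : M N →ₗ[ℂ] M N} {H : M N} {Γ : Matrix (Fin (N ^ 2)) (Fin (N ^ 2)) ℂ} :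
    IsDilatedGKSLRep F L H Γ ↔
      IsChoiGKSLRep L H (vecColumns F * Γ * (vecColumns F)ᴴ) := by
  constructor
  · intro h
    refine ⟨h.hermitian, h.traceless, h.posSemidef.mul_mul_conjTranspose_same _, ?_, fun ρ => ?_⟩
    · rw [← vec_coeffOperator, h.map_one, vec_zero]
    · rw [h.eq_form, gkslForm_eq F H Γ _ rfl]
  · intro h
    refine ⟨h.hermitian, h.traceless, ?_, ?_, fun A => ?_, fun ρ => ?_⟩
    · rw [← conjTranspose_vecColumns_mul_mul hF Γ]
      exact h.posSemidef.conjTranspose_mul_mul_same _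
    · rw [← vec_inj, vec_coeffOperator, h.mulVec_one, vec_zero]
    · have := congrArg (· ⬝ᵥ vec A) h.vecMul_one
      simp only [← dotProduct_mulVec, ← vec_coeffOperator, star_vec_dotProduct_vec] at this
      simpa using this
    · rw [h.eq_form, gkslForm_eq F H Γ _ rfl]

theorem exists_isDilatedGKSLRep {F : Fin (N ^ 2) → M N} (hF : IsHSOrthonormal F)
    {L : M N →ₗ[ℂ] M N} {H : M N} {G : Matrix (Fin N × Fin N) (Fin N × Fin N) ℂ}
    (h : IsChoiGKSLRep L H G) :
    IsDilatedGKSLRep F L H ((vecColumns F)ᴴ * G * vecColumns F) := by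
  rw [isDilatedGKSLRep_iff hF]
  rwa [Matrix.mul_assoc _ G, ← Matrix.mul_assoc, vecColumns_mul_conjTranspose hF, Matrix.one_mul, Matrix.mul_assoc,
    vecColumns_mul_conjTranspose hF, Matrix.mul_one]

theorem IsClassicalGKSLRep.isChoiGKSLRep {E : Fin (N ^ 2 - 1) → M N}
    (hE : ∀ i, (E i).trace = 0) {L : M N →ₗ[ℂ] M N} {H : M N}
    {C : Matrix (Fin (N ^ 2 - 1)) (Fin (N ^ 2 - 1)) ℂ} (h : IsClassicalGKSLRep E L H C) :
    IsChoiGKSLRep L H (vecColumns E * C * (vecColumns E)ᴴ) := by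
  refine ⟨h.hermitian, h.traceless, h.posSemidef.mul_mul_conjTranspose_same _, ?_, fun ρ => ?_⟩
  · have : (vecColumns E)ᴴ *ᵥ vec (1 : M N) = 0 := by
      ext j
      rw [conjTranspose_vecColumns_mulVec, Matrix.mul_one, trace_conjTranspose, hE, star_zero]
      rfl
    rw [← mulVec_mulVec, this, mulVec_zero]
  · rw [h.eq_form, gkslForm_eq E H C _ rfl]

/-- Appending the normalized identity to the `E i` gives an orthonormal basis, whose completeness
relation is then solved for the `E` part. -/
theorem vecColumns_mul_conjTranspose_of_traceless {E : Fin (N ^ 2 - 1) → M N}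
    (hE : IsHSOrthonormal E) (hE' : ∀ i, (E i).trace = 0) :
    vecColumns E * (vecColumns E)ᴴ = projTraceless N := by
  rcases eq_or_ne N 0 with rfl | hN
  · ext p
    exact p.1.elim0
  set s : ℂ := ((Real.sqrt N : ℝ) : ℂ)⁻¹ with hs
  have hss : star s * s = (N : ℂ)⁻¹ := by
    rw [hs, Complex.star_def, map_inv₀, Complex.conj_ofReal, ← mul_inv, ← Complex.ofReal_mul,
      Real.mul_self_sqrt (Nat.cast_nonneg N), Complex.ofReal_natCast]
  set u : Matrix (Fin N × Fin N) Unit ℂ := replicateCol Unit (s • vec (1 : M N)) with hu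
  have h1 : (fromCols (vecColumns E) u)ᴴ * fromCols (vecColumns E) u = 1 := by
    rw [conjTranspose_fromCols_eq_fromRows_conjTranspose, fromRows_mul_fromCols,
      conjTranspose_vecColumns_mul_self hE, ← fromBlocks_one]
    have hEu : (vecColumns E)ᴴ * u = 0 := by
      ext j k
      have := conjTranspose_vecColumns_mulVec E (s • (1 : M N)) j
      simp only [mul_smul_comm, Matrix.mul_one, trace_smul, trace_conjTranspose, hE',
        star_zero, smul_zero] at this
      exact this
    congr 1
    · rw [← conjTranspose_eq_zero, conjTranspose_mul, conjTranspose_conjTranspose, hEu]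
    · ext
      change star (s • vec (1 : M N)) ⬝ᵥ (s • vec (1 : M N)) = 1
      rw [star_smul, smul_dotProduct, dotProduct_smul, star_vec_one_dotProduct, smul_smul, hss,
        smul_eq_mul, inv_mul_cancel₀ (Nat.cast_ne_zero.2 hN)]
  -- The count `(N² - 1) + 1 = N²` uses `N ≠ 0`, the subtraction being truncated.
  have h2 := (mul_eq_one_comm_of_card_eq _ _ _ (by
    have : 0 < N ^ 2 := by positivity
    simp [← sq]
    omega)).1 h1
  rw [conjTranspose_fromCols_eq_fromRows_conjTranspose, fromCols_mul_fromRows] at h2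
  rw [projTraceless, ← h2, eq_comm, sub_eq_iff_eq_add]
  congr 1
  ext p q
  simp [hu, Matrix.mul_apply, vecMulVec_apply, ← hss]
  ring

theorem IsChoiGKSLRep.exists_isClassicalGKSLRep {E : Fin (N ^ 2 - 1) → M N}
    (hE : IsHSOrthonormal E) (hE' : ∀ i, (E i).trace = 0) {L : M N →ₗ[ℂ] M N} {H : M N}
    {G : Matrix (Fin N × Fin N) (Fin N × Fin N) ℂ} (h : IsChoiGKSLRep L H G) :
    IsClassicalGKSLRep E L H ((vecColumns E)ᴴ * G * vecColumns E) := by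
  refine ⟨h.hermitian, h.traceless, h.posSemidef.conjTranspose_mul_mul_same _, fun ρ => ?_⟩
  rw [h.eq_form, gkslForm_eq E H _ G]
  rw [Matrix.mul_assoc _ G, ← Matrix.mul_assoc, vecColumns_mul_conjTranspose_of_traceless hE hE', Matrix.mul_assoc,
    Matrix.mul_assoc, vecColumns_mul_conjTranspose_of_traceless hE hE', ← Matrix.mul_assoc,
    h.projTraceless_mul_mul]

/-! ### Closed cones and exponentials -/

theorem isClosed_setOf_isHermitian {n : Type*} : IsClosed {X : Matrix n n ℂ | X.IsHermitian} :=
  isClosed_eq continuous_id.matrix_conjTranspose continuous_id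

theorem isClosed_setOf_posSemidef {n : Type*} [Fintype n] :
    IsClosed {X : Matrix n n ℂ | X.PosSemidef} := by
  simp only [posSemidef_iff_dotProduct_mulVec, Set.ofPred_and, Set.ofPred_forall]
  refine isClosed_setOf_isHermitian.inter (isClosed_iInter fun x => ?_)
  exact isClosed_le continuous_const
    (continuous_const.dotProduct (continuous_id.matrix_mulVec continuous_const))

section Exp

variable {A : Type*} [NormedRing A] [NormedAlgebra ℂ A] [CompleteSpace A] {s : Subsemiring A}

theorem exp_mem_of_nonneg_smul_mem (hs : IsClosed (s : Set A))
    (hsmul : ∀ c : ℝ, 0 ≤ c → ∀ x ∈ s, (c : ℂ) • x ∈ s) {x : A} (hx : x ∈ s) :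
    NormedSpace.exp x ∈ s := by
  refine hs.mem_of_tendsto (NormedSpace.exp_series_hasSum_exp' (𝕂 := ℂ) x)
    (Eventually.of_forall fun F => sum_mem fun n _ => ?_)
  have := hsmul ((n.factorial : ℝ)⁻¹) (by positivity) _ (pow_mem hx n)
  simpa using this

/-- Since `t (x + ε y) = -(t/ε) + (t/ε) (1 + ε x + ε² y)`, its exponential is a positive scalar
times the exponential of an element of `s`. Then let `ε → 0`. -/
theorem exp_smul_mem_of_quadratic_mem (hs : IsClosed (s : Set A))
    (hsmul : ∀ c : ℝ, 0 ≤ c → ∀ x ∈ s, (c : ℂ) • x ∈ s) {x y : A}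
    (h : ∀ ε : ℝ, 0 < ε → 1 + (ε : ℂ) • x + ((ε : ℂ) ^ 2) • y ∈ s) {t : ℝ} (ht : 0 ≤ t) :
    NormedSpace.exp ((t : ℂ) • x) ∈ s := by
  let _ : NormedAlgebra ℚ A := NormedAlgebra.restrictScalars ℚ ℂ A
  have hlim : Tendsto (fun ε : ℝ => NormedSpace.exp ((t : ℂ) • (x + (ε : ℂ) • y))) (𝓝[>] 0)
      (𝓝 (NormedSpace.exp ((t : ℂ) • x))) := by
    have hc : Continuous fun ε : ℝ => NormedSpace.exp ((t : ℂ) • (x + (ε : ℂ) • y)) :=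
      NormedSpace.exp_continuous.comp (by fun_prop)
    have := (hc.tendsto 0).mono_left (nhdsWithin_le_nhds (s := Set.Ioi 0))
    simpa using this
  refine hs.mem_of_tendsto hlim (eventually_mem_nhdsWithin.mono fun ε hε => ?_)
  have hε : 0 < ε := hε
  have hε' : (ε : ℂ) ≠ 0 := by exact_mod_cast hε.ne'
  have hsplit : (t : ℂ) • (x + (ε : ℂ) • y) = algebraMap ℂ A ((-(t / ε) : ℝ) : ℂ) +
      ((t / ε : ℝ) : ℂ) • (1 + (ε : ℂ) • x + ((ε : ℂ) ^ 2) • y) := by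
    rw [Algebra.algebraMap_eq_smul_one]
    push_cast
    match_scalars <;> field_simp
    ring
  rw [hsplit, NormedSpace.exp_add_of_commute (Algebra.commutes _ _),
    ← NormedSpace.algebraMap_exp_comm, ← Complex.exp_eq_exp_ℂ, ← Complex.ofReal_exp,
    ← Algebra.smul_def]
  exact hsmul _ (Real.exp_nonneg _) _
    (exp_mem_of_nonneg_smul_mem hs hsmul (hsmul _ (div_nonneg ht hε.le) _ (h ε hε)))

end Exp

/-! ### Complete positivity and Choi's theorem -/

namespace IsCompletelyPositive

theorem add {T S : M N →ₗ[ℂ] M N} (hT : IsCompletelyPositive T) (hS : IsCompletelyPositive S) :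
    IsCompletelyPositive (T + S) := fun k X hX => (hT k X hX).add (hS k X hX)

theorem zero : IsCompletelyPositive (0 : M N →ₗ[ℂ] M N) := fun _ _ _ => PosSemidef.zero

theorem one : IsCompletelyPositive (1 : M N →ₗ[ℂ] M N) := fun _ _ hX => hX

theorem mul {T S : M N →ₗ[ℂ] M N} (hT : IsCompletelyPositive T) (hS : IsCompletelyPositive S) :
    IsCompletelyPositive (T * S) := fun k X hX => hT k _ (hS k X hX)

theorem smul {T : M N →ₗ[ℂ] M N} (hT : IsCompletelyPositive T) {c : ℝ} (hc : 0 ≤ c) :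
    IsCompletelyPositive ((c : ℂ) • T) := fun k X hX =>
  (hT k X hX).smul (Complex.zero_le_real.2 hc)

theorem sum {ι : Type*} {s : Finset ι} {T : ι → M N →ₗ[ℂ] M N}
    (hT : ∀ i ∈ s, IsCompletelyPositive (T i)) : IsCompletelyPositive (∑ i ∈ s, T i) :=
  Finset.sum_induction T IsCompletelyPositive (fun _ _ => add) zero hT

theorem choiMap_vecMulVec_self (A : M N) :
    IsCompletelyPositive (choiMap (vecMulVec (vec A) (star (vec A)))) := fun k X hX => by
  have : ampliation (choiMap (vecMulVec (vec A) (star (vec A)))) k X =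
      (kroneckerMap (· * ·) (1 : Matrix (Fin k) (Fin k) ℂ) A) * X *
        (kroneckerMap (· * ·) (1 : Matrix (Fin k) (Fin k) ℂ) A)ᴴ := by
    ext ⟨i, a⟩ ⟨j, b⟩
    simp only [ampliation, choiMap_vecMulVec, Matrix.of_apply, Matrix.mul_apply,
      Fintype.sum_prod_type, conjTranspose_apply, kroneckerMap_apply, Matrix.one_apply]
    simp only [ite_mul, zero_mul, one_mul, apply_ite star, star_zero, mul_ite, mul_zero]
    rw [Finset.sum_comm]
    simp [Finset.sum_mul, Finset.sum_ite_irrel]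
  rw [this]
  exact hX.mul_mul_conjTranspose_same _

end IsCompletelyPositive

-- Factoring `G = Bᴴ B`, the conjugated rows of `B`, reshaped into matrices, are Kraus operators.
open scoped MatrixOrder in
theorem Matrix.PosSemidef.isCompletelyPositive_choiMap
    {G : Matrix (Fin N × Fin N) (Fin N × Fin N) ℂ} (hG : G.PosSemidef) :
    IsCompletelyPositive (choiMap G) := by
  obtain ⟨B, hB⟩ := (CStarAlgebra.nonneg_iff_eq_star_mul_self (a := G)).1 hG.nonneg
  have : G = ∑ p, vecMulVec (vec (Matrix.of fun a i => star (B p (i, a))))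
      (star (vec (Matrix.of fun a i => star (B p (i, a))))) := by
    ext q r
    rw [hB, Matrix.mul_apply, Matrix.sum_apply]
    refine Finset.sum_congr rfl fun p _ => ?_
    change star (B p q) * B p r = star (B p q) * star (star (B p r))
    rw [star_star]
  rw [this, choiMap_sum]
  exact IsCompletelyPositive.sum fun p _ => IsCompletelyPositive.choiMap_vecMulVec_self _

theorem vecMulVec_vec_one_eq : vecMulVec (vec (1 : M N)) (star (vec (1 : M N))) =
    choi LinearMap.id := by
  rw [← choi_choiMap (vecMulVec _ _)]
  congr 1
  ext1 ρ
  simp [choiMap_vecMulVec]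

/-- The Choi matrix is the ampliation of `T` at the positive matrix `vec 1 (vec 1)ᴴ`. -/
theorem IsCompletelyPositive.posSemidef_choi {T : M N →ₗ[ℂ] M N} (hT : IsCompletelyPositive T) :
    (choi T).PosSemidef := by
  have h := hT N _ (posSemidef_vecMulVec_self_star (vec (1 : M N)))
  convert h using 1
  ext p q
  have hs : Matrix.single p.1 q.1 (1 : ℂ) = Matrix.of fun a b =>
      vecMulVec (vec (1 : M N)) (star (vec (1 : M N))) (p.1, a) (q.1, b) := by
    ext a b
    simp [single_apply, vecMulVec_apply, one_apply, ite_and, eq_comm]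
    split_ifs <;> rfl
  rw [choi_apply, hs]
  rfl

/-! ### The semigroup generated by a GKSL operator -/

section Semigroup

/-- The subsemiring of completely positive maps. -/
def completelyPositiveSubsemiring (N : ℕ) : Subsemiring (Module.End ℂ (M N)) where
  carrier := {T | IsCompletelyPositive T}
  mul_mem' := IsCompletelyPositive.mul
  one_mem' := IsCompletelyPositive.one
  add_mem' := IsCompletelyPositive.add
  zero_mem' := IsCompletelyPositive.zero

variable {A : Type*} [NormedRing A] [NormedAlgebra ℂ A] [FiniteDimensional ℂ A]
  (φ : Module.End ℂ (M N) ≃ₐ[ℂ] A)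

theorem continuous_symm_apply (ρ : M N) : Continuous fun a : A => φ.symm a ρ :=
  ((LinearMap.applyₗ (R := ℂ) (M₂ := M N) ρ) ∘ₗ
    φ.symm.toLinearMap).continuous_of_finiteDimensional

theorem isClosed_completelyPositiveSubsemiring :
    IsClosed ((completelyPositiveSubsemiring N).comap φ.symm.toRingHom : Set A) := by
  have : ((completelyPositiveSubsemiring N).comap φ.symm.toRingHom : Set A) =
      ⋂ (k : ℕ) (X : Matrix (Fin k × Fin N) (Fin k × Fin N) ℂ) (_ : X.PosSemidef),
        {a : A | (ampliation (φ.symm a) k X).PosSemidef} := by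
    ext T
    simp only [Set.mem_iInter]
    rfl
  rw [this]
  refine isClosed_iInter fun k => isClosed_iInter fun X => isClosed_iInter fun _ =>
    isClosed_setOf_posSemidef.preimage (f := fun a : A => ampliation (φ.symm a) k X) ?_
  exact continuous_matrix fun p q => (continuous_symm_apply φ _).matrix_elem p.2 q.2

theorem isCompletelyPositive_exp {L : M N →ₗ[ℂ] M N} {K : M N}
    {G : Matrix (Fin N × Fin N) (Fin N × Fin N) ℂ} (hG : G.PosSemidef)
    (h : ∀ ρ, L ρ = choiMap G ρ + K * ρ + ρ * Kᴴ) {t : ℝ} (ht : 0 ≤ t) :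
    IsCompletelyPositive (φ.symm (NormedSpace.exp ((t : ℂ) • φ L))) := by
  have _ : CompleteSpace A := FiniteDimensional.complete ℂ A
  -- The choice `y = K · Kᴴ` completes the square: `1 + ε L + ε² y` is `ε choiMap G` plus
  -- conjugation by `1 + ε K`.
  refine exp_smul_mem_of_quadratic_mem (isClosed_completelyPositiveSubsemiring φ)
    (fun c hc x hx => ?_) (y := φ (choiMap (vecMulVec (vec K) (star (vec K)))))
    (fun ε hε => ?_) ht
  · change IsCompletelyPositive (φ.symm ((c : ℂ) • x))
    rw [map_smul]
    exact IsCompletelyPositive.smul hx hc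
  have hcp := (hG.smul (Complex.zero_le_real.2 hε.le)).isCompletelyPositive_choiMap.add
    (IsCompletelyPositive.choiMap_vecMulVec_self (1 + (ε : ℂ) • K))
  change IsCompletelyPositive (φ.symm _)
  simp only [map_add, map_smul, map_one, AlgEquiv.symm_apply_apply]
  convert hcp using 1
  ext1 ρ
  simp only [Module.End.one_apply, h, LinearMap.add_apply,
    choiMap_smul, LinearMap.smul_apply, choiMap_vecMulVec,
    conjTranspose_add, conjTranspose_one, conjTranspose_smul, Complex.star_def,
    Complex.conj_ofReal, add_mul, mul_add, one_mul, mul_one, smul_mul_assoc, mul_smul_comm]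
  module

theorem trace_exp_smul {L : M N →ₗ[ℂ] M N} (h : ∀ ρ, (L ρ).trace = 0) (z : ℂ) (ρ : M N) :
    (φ.symm (NormedSpace.exp (z • φ L)) ρ).trace = ρ.trace := by
  have _ : CompleteSpace A := FiniteDimensional.complete ℂ A
  let τ : A →L[ℂ] ℂ := LinearMap.toContinuousLinearMap
    (Matrix.traceLinearMap (Fin N) ℂ ℂ ∘ₗ LinearMap.applyₗ (R := ℂ) (M₂ := M N) ρ ∘ₗ
      φ.symm.toLinearMap)
  have hτ : ∀ a, τ a = (φ.symm a ρ).trace := fun a => rfl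
  have hd : ∀ z : ℂ, HasDerivAt (fun z : ℂ => τ (NormedSpace.exp (z • φ L))) 0 z := fun z => by
    have h1 := τ.hasFDerivAt.comp_hasDerivAt z (hasDerivAt_exp_smul_const' (φ L) z)
    rwa [hτ, map_mul, AlgEquiv.symm_apply_apply, Module.End.mul_apply, h] at h1
  have := is_const_of_deriv_eq_zero (fun z => (hd z).differentiableAt) (fun z => (hd z).deriv) z 0
  simpa [hτ] using this

theorem tendsto_exp_slope (L : M N →ₗ[ℂ] M N) (ρ : M N) :
    Tendsto (fun t : ℝ≥0 => (t : ℝ)⁻¹ •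
      (φ.symm (NormedSpace.exp (((t : ℝ) : ℂ) • φ L)) ρ - ρ)) (𝓝[>] 0) (𝓝 (L ρ)) := by
  have _ : CompleteSpace A := FiniteDimensional.complete ℂ A
  have h1 := (hasDerivAt_exp_smul_const (φ L) (0 : ℂ)).tendsto_slope_zero
  have h2 : Tendsto (fun t : ℝ≥0 => ((t : ℝ) : ℂ)) (𝓝[>] 0) (𝓝[≠] 0) := by
    refine tendsto_nhdsWithin_of_tendsto_nhds_of_eventually_within _ ?_ ?_
    · have : Continuous fun t : ℝ≥0 => ((t : ℝ) : ℂ) := by fun_prop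
      simpa using (this.tendsto 0).mono_left (nhdsWithin_le_nhds (s := Set.Ioi 0))
    · refine eventually_mem_nhdsWithin.mono fun t ht => ?_
      have : t ≠ 0 := ne_of_gt ht
      simpa using this
  have h3 := ((continuous_symm_apply φ ρ).tendsto _).comp (h1.comp h2)
  simp only [zero_add, zero_smul, NormedSpace.exp_zero, one_mul, AlgEquiv.symm_apply_apply] at h3
  refine h3.congr fun t => ?_
  simp only [Function.comp_apply, map_smul, map_sub, map_one, LinearMap.smul_apply,
    LinearMap.sub_apply, Module.End.one_apply]
  ext i j
  simp

theorem isQDS_exp {L : M N →ₗ[ℂ] M N} {K : M N}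
    {G : Matrix (Fin N × Fin N) (Fin N × Fin N) ℂ} (hG : G.PosSemidef)
    (h : ∀ ρ, L ρ = choiMap G ρ + K * ρ + ρ * Kᴴ) (htr : ∀ ρ, (L ρ).trace = 0) :
    IsQDS fun t : ℝ≥0 => φ.symm (NormedSpace.exp (((t : ℝ) : ℂ) • φ L)) := by
  have _ : CompleteSpace A := FiniteDimensional.complete ℂ A
  let _ : NormedAlgebra ℚ A := NormedAlgebra.restrictScalars ℚ ℂ A
  refine ⟨?_, fun t s => ?_, fun ρ => ?_, fun t ρ => trace_exp_smul φ htr _ ρ,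
    fun t => isCompletelyPositive_exp φ hG h t.2⟩
  · simp [Module.End.one_eq_id]
  · rw [NNReal.coe_add, Complex.ofReal_add, add_smul, NormedSpace.exp_add_of_commute, map_mul]
    · rfl
    · exact ((Commute.refl (φ L)).smul_left _).smul_right _
  · have h1 : Continuous fun t : ℝ≥0 => NormedSpace.exp (((t : ℝ) : ℂ) • φ L) :=
      NormedSpace.exp_continuous.comp (by fun_prop)
    exact (continuous_symm_apply φ ρ).comp h1

end Semigroup

theorem isQDSGenerator_of_choiMap {L : M N →ₗ[ℂ] M N} {K : M N}
    {G : Matrix (Fin N × Fin N) (Fin N × Fin N) ℂ} (hG : G.PosSemidef)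
    (h : ∀ ρ, L ρ = choiMap G ρ + K * ρ + ρ * Kᴴ) (htr : ∀ ρ, (L ρ).trace = 0) :
    IsQDSGenerator L := by
  let _ : NormedRing (Matrix (Fin N × Fin N) (Fin N × Fin N) ℂ) := Matrix.linftyOpNormedRing
  let _ : NormedAlgebra ℂ (Matrix (Fin N × Fin N) (Fin N × Fin N) ℂ) :=
    Matrix.linftyOpNormedAlgebra
  let φ := LinearMap.toMatrixAlgEquiv (Matrix.stdBasis ℂ (Fin N) (Fin N))
  exact ⟨_, isQDS_exp φ hG h htr, tendsto_exp_slope φ L⟩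

/-! ### Choi matrices of generators -/

theorem tendsto_choi {ι : Type*} {l : Filter ι} {S : ι → M N →ₗ[ℂ] M N} {L : M N →ₗ[ℂ] M N}
    (h : ∀ x, Tendsto (fun t => S t x) l (𝓝 (L x))) :
    Tendsto (fun t => choi (S t)) l (𝓝 (choi L)) := by
  refine tendsto_pi_nhds.2 fun p => tendsto_pi_nhds.2 fun q => ?_
  exact tendsto_pi_nhds.1 (tendsto_pi_nhds.1 (h (Matrix.single p.1 q.1 1)) p.2) q.2

theorem projTraceless_mul_choi_id : projTraceless N * choi LinearMap.id = 0 := by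
  rw [← vecMulVec_vec_one_eq, mul_vecMulVec, projTraceless_mulVec_one, zero_vecMulVec]

namespace IsQDSGenerator

variable {L : M N →ₗ[ℂ] M N}

theorem trace_eq_zero (h : IsQDSGenerator L) (ρ : M N) : (L ρ).trace = 0 := by
  obtain ⟨T, hT, hL⟩ := h
  have h1 := ((continuous_id.matrix_trace (n := Fin N) (R := ℂ)).tendsto _).comp (hL ρ)
  refine tendsto_nhds_unique h1 ?_
  simp [Function.comp_def, trace_smul, trace_sub, hT.trace]

theorem exists_tendsto_choi (h : IsQDSGenerator L) : ∃ T : ℝ≥0 → (M N →ₗ[ℂ] M N), IsQDS T ∧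
    Tendsto (fun t : ℝ≥0 => (t : ℂ)⁻¹ • (choi (T t) - choi LinearMap.id)) (𝓝[>] 0)
      (𝓝 (choi L)) := by
  obtain ⟨T, hT, hL⟩ := h
  refine ⟨T, hT, ?_⟩
  have : Tendsto (fun t : ℝ≥0 => choi ((t : ℂ)⁻¹ • (T t - LinearMap.id))) (𝓝[>] 0)
      (𝓝 (choi L)) := by
    refine tendsto_choi fun x => (hL x).congr fun t => ?_
    ext i j
    simp
  simpa only [map_smul, map_sub] using this

theorem isHermitian_choi (h : IsQDSGenerator L) : (choi L).IsHermitian := by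
  obtain ⟨T, hT, hL⟩ := h.exists_tendsto_choi
  refine isClosed_setOf_isHermitian.mem_of_tendsto hL (Eventually.of_forall fun t => ?_)
  have h1 := (hT.completelyPositive t).posSemidef_choi.isHermitian
  have h2 := (IsCompletelyPositive.one (N := N)).posSemidef_choi.isHermitian
  have h3 : IsSelfAdjoint ((t : ℂ)⁻¹) := by
    rw [isSelfAdjoint_iff]
    simp
  exact (h1.sub h2).smul h3

/-- Compression removes the identity from the difference quotients, leaving nonnegative multiples of
compressed Choi matrices of completely positive maps. -/
theorem posSemidef_projTraceless_mul_choi_mul (h : IsQDSGenerator L) :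
    (projTraceless N * choi L * projTraceless N).PosSemidef := by
  obtain ⟨T, hT, hL⟩ := h.exists_tendsto_choi
  have hc : Continuous fun X : Matrix (Fin N × Fin N) (Fin N × Fin N) ℂ =>
      projTraceless N * X * projTraceless N := by fun_prop
  refine isClosed_setOf_posSemidef.mem_of_tendsto ((hc.tendsto _).comp hL)
    (Eventually.of_forall fun t => ?_)
  have h1 := (hT.completelyPositive t).posSemidef_choi.mul_mul_conjTranspose_same (projTraceless N)
  have h2 := h1.smul (Complex.zero_le_real.2 (inv_nonneg.2 t.2))
  rw [conjTranspose_projTraceless] at h2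
  change PosSemidef (projTraceless N * _ * _)
  rw [mul_smul_comm, mul_sub, projTraceless_mul_choi_id, sub_zero, smul_mul_assoc]
  simpa using h2

end IsQDSGenerator

/-! ### From a generator to its representation -/

theorem exists_eq_projTraceless_mul_mul_add {X : Matrix (Fin N × Fin N) (Fin N × Fin N) ℂ}
    (hX : X.IsHermitian) : ∃ K : M N,
      X = projTraceless N * X * projTraceless N + vecMulVec (vec K) (star (vec (1 : M N)))
        + vecMulVec (vec (1 : M N)) (star (vec K)) := by
  set v := vec (1 : M N) with hv
  set s : ℂ := star v ⬝ᵥ (X *ᵥ v) with hs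
  have hvX : star v ᵥ* X = star (X *ᵥ v) := by rw [star_mulVec, hX.eq]
  have hss : star s = s := by
    rw [hs, ← star_dotProduct, ← hvX, dotProduct_mulVec]
  -- The compression subtracts two cross terms and adds back a multiple of `v vᴴ`. That multiple is
  -- real, so it splits equally between the two `K` terms, whence the `/ 2`.
  obtain ⟨K, hK⟩ := (vec_bijective (m := Fin N) (n := Fin N) (R := ℂ)).2
    ((N : ℂ)⁻¹ • (X *ᵥ v) - ((N : ℂ)⁻¹ ^ 2 * s / 2) • v)
  refine ⟨K, ?_⟩
  have hP : projTraceless N * X * projTraceless N = X - (N : ℂ)⁻¹ • vecMulVec v (star (X *ᵥ v))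
      - (N : ℂ)⁻¹ • vecMulVec (X *ᵥ v) (star v)
      + ((N : ℂ)⁻¹ ^ 2 * s) • vecMulVec v (star v) := by
    rw [projTraceless, sub_mul, one_mul, smul_mul_assoc, vecMulVec_mul, mul_sub, mul_one,
      mul_smul_comm, sub_mul, mul_vecMulVec, smul_mul_assoc, vecMulVec_mul_vecMulVec, ← hv, hvX]
    rw [← hvX, ← dotProduct_mulVec, ← hs, vecMulVec_smul]
    module
  have hN : star ((N : ℂ)⁻¹) = (N : ℂ)⁻¹ := by simp
  rw [hK, hP, star_sub, star_smul, star_smul, sub_vecMulVec, vecMulVec_sub, smul_vecMulVec,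
    smul_vecMulVec, vecMulVec_smul, vecMulVec_smul, star_div₀, star_mul', star_pow, hN, hss,
    show star (2 : ℂ) = 2 by simp]
  module

theorem exists_isChoiGKSLRep {L : M N →ₗ[ℂ] M N} {K : M N}
    {G : Matrix (Fin N × Fin N) (Fin N × Fin N) ℂ} (hG : G.PosSemidef)
    (hG1 : G *ᵥ vec (1 : M N) = 0)
    (h : ∀ ρ, L ρ = choiMap G ρ + K * ρ + ρ * Kᴴ) (htr : ∀ ρ, (L ρ).trace = 0) :
    ∃ H, IsChoiGKSLRep L H G := by
  -- Trace annihilation, tested against every `ρ`, fixes the Hermitian part of `K`; the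
  -- anti-Hermitian part becomes the Hamiltonian.
  have hd : choiDual G = -(K + Kᴴ) := by
    rw [eq_neg_iff_add_eq_zero, ext_iff_trace_mul_right]
    intro ρ
    have := htr ρ
    rw [h, trace_add, trace_add, trace_choiMap, trace_mul_comm ρ] at this
    rw [add_mul, add_mul, trace_add, trace_add, ← add_assoc, this]
    simp
  obtain ⟨H₀, hH₀⟩ : ∃ H₀ : M N, H₀ = (Complex.I / 2) • (K - Kᴴ) := ⟨_, rfl⟩
  have hH₀' : H₀.IsHermitian := by
    rw [IsHermitian, hH₀, conjTranspose_smul, conjTranspose_sub, conjTranspose_conjTranspose,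
      Complex.star_def, map_div₀, Complex.conj_I, map_ofNat]
    module
  have ht : star H₀.trace = H₀.trace := by rw [← trace_conjTranspose, hH₀'.eq]
  -- Subtracting a scalar makes the Hamiltonian traceless without changing its commutators.
  refine ⟨H₀ - (H₀.trace / N) • 1, ?_, ?_, hG, hG1, fun ρ => ?_⟩
  · rw [IsHermitian, conjTranspose_sub, hH₀'.eq, conjTranspose_smul, conjTranspose_one,
      star_div₀, ht, star_natCast]
  · rcases eq_or_ne N 0 with rfl | hN
    · simp [Matrix.trace]
    · have : (N : ℂ) ≠ 0 := Nat.cast_ne_zero.2 hN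
      rw [trace_sub, trace_smul, trace_one, Fintype.card_fin, smul_eq_mul, div_mul_cancel₀ _ this,
        sub_self]
  · rw [h, hd, hH₀]
    simp only [Ring.lie_def, sub_mul, mul_sub, add_mul, mul_add, neg_mul, mul_neg, smul_mul_assoc,
      mul_smul_comm, one_mul, mul_one, smul_sub, smul_add, smul_neg, smul_smul]
    have hI : Complex.I * (Complex.I / 2) = -(1 / 2) := by
      rw [← mul_div_assoc, Complex.I_mul_I]
      ring
    rw [hI]
    module

theorem isQDSGenerator_iff {L : M N →ₗ[ℂ] M N} :
    IsQDSGenerator L ↔ ∃ H G, IsChoiGKSLRep L H G := by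
  constructor
  · intro h
    obtain ⟨K, hK⟩ := exists_eq_projTraceless_mul_mul_add h.isHermitian_choi
    obtain ⟨H, hH⟩ := exists_isChoiGKSLRep (L := L) (K := K)
      h.posSemidef_projTraceless_mul_choi_mul
      (by rw [← mulVec_mulVec, projTraceless_mulVec_one, mulVec_zero]) (fun ρ => by
        conv_lhs => rw [← choiMap_choi L, hK]
        simp [choiMap_add, choiMap_vecMulVec]) h.trace_eq_zero
    exact ⟨H, _, hH⟩
  · rintro ⟨H, G, h⟩
    refine isQDSGenerator_of_choiMap h.posSemidef h.eq_form' fun ρ => ?_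
    rw [h.eq_form]
    simp only [Ring.lie_def, trace_sub, trace_add, trace_neg, trace_smul, trace_choiMap]
    rw [trace_mul_comm H ρ, trace_mul_comm ρ (choiDual G), smul_eq_mul, smul_eq_mul]
    ring

theorem mainTheorem6 (N : ℕ) (F : Fin (N ^ 2) → M N) (hF : IsHSOrthonormal F)
    (L : M N →ₗ[ℂ] M N) :
    (IsQDSGenerator L ↔
      ∃ (H : M N) (Γ : Matrix (Fin (N ^ 2)) (Fin (N ^ 2)) ℂ), IsDilatedGKSLRep F L H Γ) ∧
    (∀ (H : M N) (Γ : Matrix (Fin (N ^ 2)) (Fin (N ^ 2)) ℂ), IsDilatedGKSLRep F L H Γ →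
      -- `Γ` is determined by `L` and `F`
      (∀ (H' : M N) (Γ' : Matrix (Fin (N ^ 2)) (Fin (N ^ 2)) ℂ),
        IsDilatedGKSLRep F L H' Γ' → Γ' = Γ) ∧
      -- `H` is determined by `L` alone, whatever the orthonormal basis
      (∀ F' : Fin (N ^ 2) → M N, IsHSOrthonormal F' →
        ∀ (H' : M N) (Γ' : Matrix (Fin (N ^ 2)) (Fin (N ^ 2)) ℂ),
          IsDilatedGKSLRep F' L H' Γ' → H' = H) ∧
      -- `H` is the traceless Hamiltonian of the classical GKSL form of `L`
      (∀ E : Fin (N ^ 2 - 1) → M N, IsHSOrthonormal E → (∀ i, (E i).trace = 0) →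
        ∀ H' : M N,
          (∃ C : Matrix (Fin (N ^ 2 - 1)) (Fin (N ^ 2 - 1)) ℂ, IsClassicalGKSLRep E L H' C) ↔
            H' = H)) := by
  refine ⟨isQDSGenerator_iff.trans ⟨?_, ?_⟩, fun H Γ h => ?_⟩
  · rintro ⟨H, G, h⟩
    exact ⟨H, _, exists_isDilatedGKSLRep hF h⟩
  · rintro ⟨H, Γ, h⟩
    exact ⟨H, _, (isDilatedGKSLRep_iff hF).1 h⟩
  have hc := (isDilatedGKSLRep_iff hF).1 h
  refine ⟨fun H' Γ' h' => ?_, fun F' hF' H' Γ' h' => ?_, fun E hE hE' H' => ⟨?_, ?_⟩⟩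
  · rw [← conjTranspose_vecColumns_mul_mul hF Γ', ← conjTranspose_vecColumns_mul_mul hF Γ,
      hc.choi_unique ((isDilatedGKSLRep_iff hF).1 h')]
  · exact hc.hamiltonian_unique ((isDilatedGKSLRep_iff hF').1 h')
  · rintro ⟨C, hC⟩
    exact hc.hamiltonian_unique (hC.isChoiGKSLRep hE')
  · rintro rfl
    exact ⟨_, hc.exists_isClassicalGKSLRep hE hE'⟩
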